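/- **Theorem.** Let $n\ge 1$, let $(X_k)_{k\ge1}$ be an $\mathbb{R}^n$-valued discrete-time stochastic process adapted to a filtration $(\mathcal F_k)_{k\ge1}$, and let $\nu_\infty$ be a probability measure on $\mathbb{R}^n$ with $\mathbb{E}_{\nu_\infty}\|X\|^2<\infty$ (the stationary distribution of the process). For $a\ge 1$ let $$\beta(a):=\sup_{t\ge1}\ \mathbb{E}\Big[\big\|\mathbb{P}(X_{t+a}\in\cdot\mid\mathcal F_t)-\nu_\infty\big\|_{\mathrm{tv}}\Big],\qquad \|P-Q\|_{\mathrm{tv}}:=\sup_{A}|P(A)-Q(A)|,$$ and suppose that $\beta(a)\le\Gamma\rho^a$ for all integers $a\ge1$, where $\Gamma>0$ and $\rho\in(0,1)$. For $\tau>0$ define the small-ball probability $$Q_\infty(\tau):=\inf_{t\in S^{n-1}}\nu_\infty\{x:\ |\langle t,x\rangle|\ge\tau\}.$$ Let $\delta\in(0,1)$, let $\tau>0$ satisfy $Q_\infty(\tau)>0$, and let $N\ge1$ be an integer such that $$\frac1{1-\rho}\log\Big(\frac{2\Gamma N}{\delta}\Big)\ \ge\ \frac12$$ and $$N\ \ge\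 \frac1{1-\rho}\log\Big(\frac{2\Gamma N}{\delta}\Big)\left(\max\left\{\frac{1024\,\mathbb{E}_{\nu_\infty}\|X\|^2}{\tau^2Q_\infty^2(\tau)},\ \frac{32}{Q_\infty^2(\tau)}\log\Big(\frac{4}{\delta(1-\rho)}\log\Big(\frac{2\Gamma N}{\delta}\Big)\Big)\right\}+1\right).$$ Then, with probability at least $1-\delta$, $$\lambda_{\min}\Big(\frac1N\sum_{k=1}^N X_kX_k^{\top}\Big)\ \ge\ \frac{\tau^2Q_\infty(\tau)}{8}.$$ -/

import Mathlib

open MeasureTheory ProbabilityTheory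
open scoped ENNReal

namespace MixingCovariance

noncomputable section

/-- Total variation distance of two measures, `sup_A |P(A) - Q(A)|` over measurable sets `A`. -/
def tvDist {E : Type*} [MeasurableSpace E] (P Q : Measure E) : ℝ≥0∞ :=
  ⨆ (A : Set E) (_ : MeasurableSet A), ENNReal.ofReal |P.real A - Q.real A|

/-- Regular conditional distribution of the random variable `Y` given a sub-σ-algebra `m`: the
conditional distribution of `Y` given the identity map, viewed as a random variable with values in
`Ω` equipped with the σ-algebra `m`. -/
def condLaw {Ω E : Type*} [MeasurableSpace E] [StandardBorelSpace E] [Nonempty E]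
    (m : MeasurableSpace Ω) {mΩ : MeasurableSpace Ω} (μ : Measure Ω) [IsFiniteMeasure μ]
    (Y : Ω → E) : @Kernel Ω E m _ :=
  @condDistrib Ω Ω E _ _ _ mΩ m Y (fun ω => ω) μ _

/-- The `β`-mixing coefficient of `(X_k)_{k ≥ 1}` with respect to the distribution `ν` and the
filtration `ℱ`: `β(k) = sup_{t ≥ 1} 𝔼 ‖ℙ(X_{t+k} ∈ · | ℱ_t) - ν‖_tv`. -/
def betaMixing {Ω E : Type*} [MeasurableSpace E] [StandardBorelSpace E] [Nonempty E]
    {mΩ : MeasurableSpace Ω} (μ : Measure Ω) [IsFiniteMeasure μ] (ℱ : Filtration ℕ mΩ)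
    (X : ℕ → Ω → E) (ν : Measure E) (k : ℕ) : ℝ≥0∞ :=
  ⨆ (t : ℕ) (_ : 1 ≤ t), ∫⁻ ω, tvDist (condLaw (ℱ t) μ (X (t + k)) ω) ν ∂μ

/-- The small-ball probability `Q(τ) = inf_{‖t‖ = 1} ν {x : |⟨t, x⟩| ≥ τ}`. -/
def smallBall {n : ℕ} (ν : Measure (EuclideanSpace ℝ (Fin n))) (τ : ℝ) : ℝ :=
  ⨅ t : Metric.sphere (0 : EuclideanSpace ℝ (Fin n)) 1, ν.real {x | τ ≤ |inner ℝ t.1 x|}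

/-- The empirical covariance matrix `(1/N) ∑_{k=1}^N x_k x_kᵀ`. -/
def sampleCov {n : ℕ} (N : ℕ) (x : ℕ → EuclideanSpace ℝ (Fin n)) : Matrix (Fin n) (Fin n) ℝ :=
  (1 / (N : ℝ)) • ∑ k ∈ Finset.Icc 1 N, Matrix.vecMulVec (x k).ofLp (x k).ofLp

/-- The smallest eigenvalue of a real symmetric matrix (the spectrum of a real matrix over `ℝ` is
the finite set of its real eigenvalues). -/
def lambdaMin {n : ℕ} (A : Matrix (Fin n) (Fin n) ℝ) : ℝ :=
  sInf (spectrum ℝ A)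

end

end MixingCovariance

/-! Let `a` be the mixing time `log (2ΓN/δ) / (1 - ρ)`, rounded up. Within one residue class of
indices mod `a`, each observation has, given the earlier ones, a conditional law that is on average
within `β(a)` of `ν`. Replacing the `m` observations of a class by independent draws one at a time
costs `m β(a)` in probability (`lintegral_sum_le_iterate_lintShift`), and over all `a` classes at
most `N Γ ρ^a ≤ δ/2`.

For independent draws, `s² ≥ (τ²/4) ramp τ s`, where the ramp takes values in `[0, 1]` and has mean
at least `Q = smallBall ν τ` in every unit direction. The expected worst shortfall of its empirical
mean is at most `Q/5`: symmetrization and contraction pass to linear functionals, whose Rademacher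
average is bounded by the second moment (`iterate_shiftAvg_linFeature_le`). A bounded difference
argument loses another `Q/5`, outside probability `exp (-2 (Q/5)² m)`
(`iterate_lintShift_indicator_le`). What remains is `3Q/5` per used index, at least `Q/2` per index
after the boundary loss, hence `τ²Q/8`.

No product space appears: an expectation over `k` independent draws is the `k`-th iterate of a
one-draw averaging operator acting on functions of the running sum. No bound depends on the number
of directions, so finite families exhausting a dense sequence give the whole sphere. -/

namespace MixingCovariance

/-! ### One-draw averaging operators on Lipschitz functions. -/

section ShiftAverage

variable {A B V : Type*} [MeasurableSpace A] [MeasurableSpace B] [NormedAddCommGroup V]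

/-- The average of the translates of `G` by a random vector `f` with law determined by `α`. -/
noncomputable def shiftAvg (α : Measure A) (f : A → V) (G : V → ℝ) (u : V) : ℝ :=
  ∫ x, G (u + f x) ∂α

theorem abs_le_of_lipschitz {G : V → ℝ} (hG : LipschitzWith 1 G) (u w : V) :
    |G (u + w)| ≤ |G u| + ‖w‖ := by
  have h := hG.dist_le_mul (u + w) u
  rw [Real.dist_eq, NNReal.coe_one, one_mul, dist_eq_norm, add_sub_cancel_left] at h
  have := abs_sub_abs_le_abs_sub (G (u + w)) (G u)
  linarith

theorem integrable_shift {α : Measure A} [IsFiniteMeasure α] {f : A → V} (hf : Integrable f α)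
    {G : V → ℝ} (hG : LipschitzWith 1 G) (u : V) : Integrable (fun x => G (u + f x)) α := by
  refine Integrable.mono' ((integrable_const |G u|).add hf.norm) ?_ (.of_forall fun x => ?_)
  · exact (hG.continuous.comp (continuous_const.add continuous_id)).comp_aestronglyMeasurable hf.1
  · exact abs_le_of_lipschitz hG u (f x)

theorem lipschitz_shiftAvg {α : Measure A} [IsProbabilityMeasure α] {f : A → V}
    (hf : Integrable f α) {G : V → ℝ} (hG : LipschitzWith 1 G) :
    LipschitzWith 1 (shiftAvg α f G) := by
  refine LipschitzWith.of_dist_le_mul fun u v => ?_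
  rw [Real.dist_eq, shiftAvg, shiftAvg,
    ← integral_sub (integrable_shift hf hG u) (integrable_shift hf hG v)]
  have hb : ∀ᵐ x ∂α, ‖G (u + f x) - G (v + f x)‖ ≤ dist u v := .of_forall fun x => by
    simpa [Real.dist_eq] using hG.dist_le_mul (u + f x) (v + f x)
  simpa using norm_integral_le_of_norm_le_const hb

/-- Fubini. Independent steps commute, so in an iterate any single step can be moved to the front
and replaced. -/
theorem shiftAvg_comm {α : Measure A} [IsProbabilityMeasure α] {β : Measure B}
    [IsProbabilityMeasure β] {f : A → V} {g : B → V} (hf : Integrable f α) (hg : Integrable g β)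
    {G : V → ℝ} (hG : LipschitzWith 1 G) :
    shiftAvg α f (shiftAvg β g G) = shiftAvg β g (shiftAvg α f G) := by
  ext u
  have hs : Integrable (fun z : A × B => f z.1 + g z.2) (α.prod β) :=
    (hf.comp_fst β).add (hg.comp_snd α)
  have hi := integrable_shift hs hG u
  simp only [shiftAvg]
  rw [integral_integral_swap (f := fun x y => G (u + f x + g y))]
  · simp only [add_right_comm]
  · simpa [Function.uncurry_def, add_assoc] using hi

theorem shiftAvg_mono {α : Measure A} [IsFiniteMeasure α] {f : A → V} (hf : Integrable f α)
    {G H : V → ℝ} (hG : LipschitzWith 1 G) (hH : LipschitzWith 1 H) (hGH : ∀ u, G u ≤ H u)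
    (u : V) : shiftAvg α f G u ≤ shiftAvg α f H u :=
  integral_mono (integrable_shift hf hG u) (integrable_shift hf hH u) fun _ => hGH _

theorem lipschitz_iterate_shiftAvg {α : Measure A} [IsProbabilityMeasure α] {f : A → V}
    (hf : Integrable f α) {G : V → ℝ} (hG : LipschitzWith 1 G) (k : ℕ) :
    LipschitzWith 1 ((shiftAvg α f)^[k] G) := by
  induction k with
  | zero => exact hG
  | succ k ih => rw [Function.iterate_succ_apply']; exact lipschitz_shiftAvg hf ih

theorem lipschitz_half_add {G H : V → ℝ} (hG : LipschitzWith 1 G) (hH : LipschitzWith 1 H) :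
    LipschitzWith 1 (fun u => (G u + H u) / 2) := by
  refine LipschitzWith.of_dist_le_mul fun u v => ?_
  have h1 := hG.dist_le_mul u v
  have h2 := hH.dist_le_mul u v
  simp only [Real.dist_eq, NNReal.coe_one, one_mul, abs_le] at *
  constructor <;> linarith

theorem shiftAvg_half_add {α : Measure A} [IsFiniteMeasure α] {f : A → V} (hf : Integrable f α)
    {G H : V → ℝ} (hG : LipschitzWith 1 G) (hH : LipschitzWith 1 H) (u : V) :
    shiftAvg α f (fun u => (G u + H u) / 2) u = (shiftAvg α f G u + shiftAvg α f H u) / 2 := by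
  simp only [shiftAvg]
  rw [integral_div, integral_add (integrable_shift hf hG u) (integrable_shift hf hH u)]

end ShiftAverage

/-! ### The maximum functional: convexity and contraction. -/

section MaxCoordinate

variable {ι : Type*}

/-- The largest coordinate of a vector. -/
noncomputable def maxCoord (u : ι → ℝ) : ℝ := ⨆ i, u i

theorem le_maxCoord [Finite ι] (u : ι → ℝ) (i : ι) : u i ≤ maxCoord u :=
  le_ciSup (Set.finite_range u).bddAbove i

theorem maxCoord_le [Nonempty ι] {u : ι → ℝ} {c : ℝ} (h : ∀ i, u i ≤ c) : maxCoord u ≤ c := ciSup_le h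

variable [Fintype ι] [Nonempty ι]

theorem exists_eq_maxCoord (u : ι → ℝ) : ∃ i, u i = maxCoord u := exists_eq_ciSup_of_finite

theorem maxCoord_mono {u v : ι → ℝ} (h : u ≤ v) : maxCoord u ≤ maxCoord v :=
  maxCoord_le fun i => (h i).trans (le_maxCoord v i)

theorem maxCoord_add_const (u : ι → ℝ) (c : ℝ) :
    maxCoord (fun i => u i + c) = maxCoord u + c := by
  apply le_antisymm
  · exact maxCoord_le fun i => by linarith [le_maxCoord u i]
  · obtain ⟨i, hi⟩ := exists_eq_maxCoord u
    rw [← hi]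
    exact le_maxCoord (fun i => u i + c) i

theorem lipschitz_maxCoord : LipschitzWith 1 (maxCoord : (ι → ℝ) → ℝ) := by
  refine LipschitzWith.of_le_add fun u v => maxCoord_le fun i => ?_
  have h1 := le_maxCoord v i
  have h2 := dist_le_pi_dist u v i
  rw [Real.dist_eq] at h2
  linarith [le_abs_self (u i - v i)]

/-- Convexity of `maxCoord` along a midpoint. -/
theorem maxCoord_midpoint_le (u p q : ι → ℝ) :
    maxCoord (u + (p - q)) ≤
      (maxCoord (u + (2 : ℝ) • p) + maxCoord (u + -((2 : ℝ) • q))) / 2 := by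
  refine maxCoord_le fun i => ?_
  have h1 := le_maxCoord (u + (2 : ℝ) • p) i
  have h2 := le_maxCoord (u + -((2 : ℝ) • q)) i
  simp only [Pi.add_apply, Pi.sub_apply, Pi.smul_apply, Pi.neg_apply, smul_eq_mul] at *
  linarith

/-- The contraction principle for one symmetric sign. -/
theorem maxCoord_contraction (u : ι → ℝ) {a b : ι → ℝ}
    (hab : ∀ i j, |a i - a j| ≤ |b i - b j|) :
    maxCoord (u + a) + maxCoord (u + -a) ≤ maxCoord (u + b) + maxCoord (u + -b) := by
  obtain ⟨i, hi⟩ := exists_eq_maxCoord (u + a)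
  obtain ⟨j, hj⟩ := exists_eq_maxCoord (u + -a)
  have h := hab i j
  have h1 := le_maxCoord (u + b) i
  have h2 := le_maxCoord (u + -b) j
  have h3 := le_maxCoord (u + b) j
  have h4 := le_maxCoord (u + -b) i
  have h5 := le_abs_self (a i - a j)
  rw [← hi, ← hj]
  simp only [Pi.add_apply, Pi.neg_apply] at *
  rcases abs_cases (b i - b j) with h6 | h6 <;> linarith

end MaxCoordinate

/-! ### Symmetrization and contraction without a ghost sample. -/

section Symmetrization

variable {E ι : Type*} [MeasurableSpace E] [Fintype ι]

/-- The deviation of the feature vector `φ` from its mean. -/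
noncomputable def deviation (ν : Measure E) (φ : E → ι → ℝ) (x : E) : ι → ℝ :=
  (∫ y, φ y ∂ν) - φ x

theorem integrable_deviation {ν : Measure E} [IsFiniteMeasure ν] {φ : E → ι → ℝ}
    (hφ : Integrable φ ν) : Integrable (deviation ν φ) ν :=
  (integrable_const _).sub hφ

variable [Nonempty ι]

/-- Symmetrization and contraction for one sample. -/
theorem shiftAvg_deviation_maxCoord_le {ν : Measure E} [IsProbabilityMeasure ν] {φ b : E → ι → ℝ}
    (hφ : Integrable φ ν) (hb : Integrable b ν)
    (hφb : ∀ x i j, |2 * φ x i - 2 * φ x j| ≤ |b x i - b x j|) (u : ι → ℝ) :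
    shiftAvg ν (deviation ν φ) maxCoord u ≤
      (shiftAvg ν b maxCoord u + shiftAvg ν (-b) maxCoord u) / 2 := by
  have hL := lipschitz_maxCoord (ι := ι)
  have i1 : Integrable (fun x => maxCoord (u + (2 : ℝ) • φ x)) ν :=
    integrable_shift (hφ.smul (2 : ℝ)) hL u
  have i2 : Integrable (fun x => maxCoord (u + -((2 : ℝ) • φ x))) ν :=
    integrable_shift (hφ.smul (2 : ℝ)).neg hL u
  have i3 := integrable_shift hb hL u
  have i4 : Integrable (fun x => maxCoord (u + -b x)) ν := integrable_shift hb.neg hL u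
  have i0 := integrable_shift (integrable_deviation hφ) hL u
  -- Jensen. The midpoint bound separates the mean from the sample, so after integration the same
  -- `x` can serve in both terms; the price is the factor 2 on the features.
  have hp : maxCoord (u + (2 : ℝ) • ∫ y, φ y ∂ν) ≤ ∫ x, maxCoord (u + (2 : ℝ) • φ x) ∂ν := by
    refine maxCoord_le fun i => ?_
    have hi : Integrable (fun x => φ x i) ν := hφ.eval i
    have e : (u + (2 : ℝ) • ∫ y, φ y ∂ν) i = ∫ x, (u i + 2 * φ x i) ∂ν := by
      rw [integral_add (integrable_const _) (hi.const_mul 2), integral_const_mul]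
      simp [eval_integral (fun i => hφ.eval i)]
    rw [e]
    refine integral_mono ((integrable_const _).add (hi.const_mul 2)) i1 fun x => ?_
    exact le_maxCoord (u + (2 : ℝ) • φ x) i
  have hc : ∫ x, (maxCoord (u + (2 : ℝ) • φ x) + maxCoord (u + -((2 : ℝ) • φ x))) ∂ν ≤
      ∫ x, (maxCoord (u + b x) + maxCoord (u + -b x)) ∂ν :=
    integral_mono (i1.add i2) (i3.add i4) fun x =>
      maxCoord_contraction u fun i j => by simpa using hφb x i j
  have hm : shiftAvg ν (deviation ν φ) maxCoord u ≤
      ∫ x, (maxCoord (u + (2 : ℝ) • ∫ y, φ y ∂ν) + maxCoord (u + -((2 : ℝ) • φ x))) / 2 ∂ν :=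
    integral_mono i0 (((integrable_const _).add i2).div_const 2) fun x =>
      maxCoord_midpoint_le u _ _
  rw [integral_div, integral_add (integrable_const _) i2, integral_const] at hm
  rw [integral_add i1 i2, integral_add i3 i4] at hc
  simp only [probReal_univ, one_smul] at hm
  simp only [shiftAvg, Pi.neg_apply] at *
  linarith

/-- The one-sample inequality is about `maxCoord` only. Applied at the innermost step, it is carried
outward through the other steps by monotonicity and commutation. -/
theorem iterate_shiftAvg_deviation_maxCoord_le {ν : Measure E} [IsProbabilityMeasure ν]
    {φ b : E → ι → ℝ} (hφ : Integrable φ ν) (hb : Integrable b ν)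
    (hφb : ∀ x i j, |2 * φ x i - 2 * φ x j| ≤ |b x i - b x j|) (k : ℕ) (u : ι → ℝ) :
    (shiftAvg ν (deviation ν φ))^[k + 1] maxCoord u ≤
      (shiftAvg ν b ((shiftAvg ν (deviation ν φ))^[k] maxCoord) u +
        shiftAvg ν (-b) ((shiftAvg ν (deviation ν φ))^[k] maxCoord) u) / 2 := by
  have hd := integrable_deviation hφ
  induction k generalizing u with
  | zero => exact shiftAvg_deviation_maxCoord_le hφ hb hφb u
  | succ k ih =>
    have hk := lipschitz_iterate_shiftAvg hd (lipschitz_maxCoord (ι := ι)) k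
    have hk1 := lipschitz_iterate_shiftAvg hd (lipschitz_maxCoord (ι := ι)) (k + 1)
    have l1 := lipschitz_shiftAvg hb hk
    have l2 := lipschitz_shiftAvg hb.neg hk
    rw [Function.iterate_succ_apply']
    refine (shiftAvg_mono hd hk1 (lipschitz_half_add l1 l2) ih u).trans_eq ?_
    rw [shiftAvg_half_add hd l1 l2, shiftAvg_comm hd hb hk, shiftAvg_comm hd hb.neg hk,
      Function.iterate_succ_apply']

end Symmetrization

/-! ### Rademacher complexity of linear functionals. -/

section Rademacher

variable {E ι : Type*} [NormedAddCommGroup E] [InnerProductSpace ℝ E]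

/-- The linear features `x ↦ c ⟪d i, x⟫`. -/
noncomputable def linFeature (c : ℝ) (d : ι → E) (x : E) : ι → ℝ := fun i => c * inner ℝ (d i) x

theorem linFeature_add (c : ℝ) (d : ι → E) (x y : E) :
    linFeature c d x + linFeature c d y = linFeature c d (x + y) := by
  ext i; simp [linFeature, inner_add_right, mul_add]

theorem linFeature_neg (c : ℝ) (d : ι → E) (x : E) :
    - linFeature c d x = linFeature c d (-x) := by
  ext i; simp [linFeature]

/-- The graph of the square root lies below its tangent at `w ^ 2`. Linearizing allows integration
over the sample. -/
theorem half_sqrt_add_sqrt_le {a b w : ℝ} (ha : 0 ≤ a) (hb : 0 ≤ b) (hw : 0 < w) :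
    (√a + √b) / 2 ≤ ((a + b) / 2 + w ^ 2) / (2 * w) := by
  rw [le_div_iff₀ (by positivity)]
  nlinarith [sq_nonneg (√a - w), sq_nonneg (√b - w), Real.sq_sqrt ha, Real.sq_sqrt hb]

variable [MeasurableSpace E] [Fintype ι] [Nonempty ι]

/-- The expected maximal deviation, bounded through the Rademacher complexity of a linear class. -/
theorem iterate_shiftAvg_linFeature_le {ν : Measure E} [IsProbabilityMeasure ν]
    {φ : E → ι → ℝ} (hφ : Integrable φ ν) {c : ℝ} (hc : 0 ≤ c) {d : ι → E}
    (hd : ∀ i, ‖d i‖ ≤ 1) (hb : Integrable (linFeature c d) ν)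
    (hφb : ∀ x i j, |2 * φ x i - 2 * φ x j| ≤ |linFeature c d x i - linFeature c d x j|)
    (hν : Integrable (fun x => ‖x‖ ^ 2) ν) (hσ : 0 < ∫ x, ‖x‖ ^ 2 ∂ν) (k : ℕ) (v : E) :
    (shiftAvg ν (deviation ν φ))^[k] maxCoord (linFeature c d v) ≤
      c * √(‖v‖ ^ 2 + k * ∫ x, ‖x‖ ^ 2 ∂ν) := by
  induction k generalizing v with
  | zero =>
    simp only [Function.iterate_zero, id_eq, CharP.cast_eq_zero, zero_mul, add_zero,
      Real.sqrt_sq (norm_nonneg v)]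
    refine maxCoord_le fun i => mul_le_mul_of_nonneg_left ?_ hc
    exact (real_inner_le_norm _ _).trans (mul_le_of_le_one_left (norm_nonneg v) (hd i))
  | succ k ih =>
    set s := ∫ x, ‖x‖ ^ 2 ∂ν with hs
    have hk := lipschitz_iterate_shiftAvg (integrable_deviation hφ)
      (lipschitz_maxCoord (ι := ι)) k
    have i1 := integrable_shift hb hk (linFeature c d v)
    have i2 := integrable_shift hb.neg hk (linFeature c d v)
    refine (iterate_shiftAvg_deviation_maxCoord_le hφ hb hφb k _).trans ?_
    simp only [shiftAvg]
    rw [← integral_add i1 i2, ← integral_div]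
    -- The tangent point is the mean of the quantity under the root, so the linearization loses
    -- nothing beyond Jensen.
    set w := √(‖v‖ ^ 2 + (k + 1 : ℕ) * s) with hw
    have hpos : 0 < ‖v‖ ^ 2 + (k + 1 : ℕ) * s := by positivity
    have hw0 : 0 < w := Real.sqrt_pos.2 hpos
    have hw2 : w ^ 2 = ‖v‖ ^ 2 + (k + 1 : ℕ) * s := Real.sq_sqrt hpos.le
    have hmono : ∀ x, ((shiftAvg ν (deviation ν φ))^[k] maxCoord
          (linFeature c d v + linFeature c d x) +
        (shiftAvg ν (deviation ν φ))^[k] maxCoord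
          (linFeature c d v + -linFeature c d x)) / 2 ≤
        c / (2 * w) * (‖x‖ ^ 2 + (‖v‖ ^ 2 + k * s + w ^ 2)) := by
      intro x
      -- The signed running sum is again a linear feature, of `v + x` or `v - x`, so the induction
      -- hypothesis applies; averaging over the sign removes the cross term by the parallelogram
      -- law.
      rw [linFeature_neg, linFeature_add, linFeature_add]
      have h1 := ih (v + x)
      have h2 := ih (v + -x)
      have h3 := half_sqrt_add_sqrt_le (a := ‖v + x‖ ^ 2 + k * s) (b := ‖v + -x‖ ^ 2 + k * s)
        (by positivity) (by positivity) hw0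
      have h4 : (‖v + x‖ ^ 2 + k * s + (‖v + -x‖ ^ 2 + k * s)) / 2 =
          ‖x‖ ^ 2 + (‖v‖ ^ 2 + k * s) := by
        have := parallelogram_law_with_norm ℝ v x
        rw [← sub_eq_add_neg]
        nlinarith
      rw [h4] at h3
      have h5 := mul_le_mul_of_nonneg_left h3 hc
      calc _ ≤ c * ((√(‖v + x‖ ^ 2 + k * s) + √(‖v + -x‖ ^ 2 + k * s)) / 2) := by linarith
        _ ≤ _ := h5
        _ = _ := by ring
    refine (integral_mono ((i1.add i2).div_const 2)
      ((hν.add (integrable_const _)).const_mul _) hmono).trans_eq ?_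
    rw [integral_const_mul, integral_add' hν (integrable_const _), integral_const]
    simp only [probReal_univ, one_smul, ← hs]
    have e : s + (‖v‖ ^ 2 + k * s + w ^ 2) = 2 * w ^ 2 := by rw [hw2]; push_cast; ring
    rw [e]
    field_simp

end Rademacher

/-! ### Exponential moments and bounded differences. -/

section Hoeffding

variable {E : Type*} [MeasurableSpace E]

/-- Hoeffding's lemma for a variable with values in an interval of length one. -/
theorem integral_exp_le_of_mem_Icc {ν : Measure E} [IsProbabilityMeasure ν] {Y : E → ℝ} {b : ℝ}
    (hY : AEMeasurable Y ν) (hb : ∀ x, Y x ∈ Set.Icc (b - 1) b) (s : ℝ) :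
    ∫ x, Real.exp (s * Y x) ∂ν ≤ Real.exp (s * ∫ x, Y x ∂ν + s ^ 2 / 8) := by
  have h := (hasSubgaussianMGF_of_mem_Icc hY (.of_forall hb)).mgf_le s
  have e : ∀ x, Real.exp (s * Y x) =
      Real.exp (s * ∫ x, Y x ∂ν) * Real.exp (s * (Y x - ∫ x, Y x ∂ν)) := by
    intro x
    rw [← Real.exp_add]
    ring_nf
  simp_rw [e]
  rw [integral_const_mul, Real.exp_add]
  refine mul_le_mul_of_nonneg_left (h.trans_eq ?_) (Real.exp_nonneg _)
  congr 1
  simp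
  ring

variable {V : Type*} [AddCommGroup V]

/-- The average of the translates of an extended nonnegative function by a random vector. -/
noncomputable def lintShift (ν : Measure E) (f : E → V) (G : V → ℝ≥0∞) (u : V) : ℝ≥0∞ :=
  ∫⁻ x, G (u + f x) ∂ν

theorem lintShift_mono (ν : Measure E) (f : E → V) : Monotone (lintShift ν f) :=
  fun _ _ h _ => lintegral_mono fun _ => h _

theorem lintShift_const_mul (ν : Measure E) (f : E → V) {c : ℝ≥0∞} (hc : c ≠ ∞)
    (G : V → ℝ≥0∞) (u : V) :
    lintShift ν f (fun u => c * G u) u = c * lintShift ν f G u :=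
  lintegral_const_mul' c _ hc

variable {ι : Type*} [Fintype ι]

/-- Since all features lie in `[0, 1]`, monotonicity and translation equivariance confine `G (u +
deviation ν φ x)` to an interval of length one, and Hoeffding's lemma applies. -/
theorem lintShift_exp_le {ν : Measure E} [IsProbabilityMeasure ν] {φ : E → ι → ℝ}
    (hφ : Integrable φ ν) (hφ0 : ∀ x, 0 ≤ φ x) (hφ1 : ∀ x, φ x ≤ 1) {G : (ι → ℝ) → ℝ}
    (hG : LipschitzWith 1 G) (hmono : Monotone G)
    (hadd : ∀ u c, G (fun i => u i + c) = G u + c) (s : ℝ) (u : ι → ℝ) :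
    lintShift ν (deviation ν φ) (fun u => ENNReal.ofReal (Real.exp (s * G u))) u ≤
      ENNReal.ofReal (Real.exp (s * shiftAvg ν (deviation ν φ) G u + s ^ 2 / 8)) := by
  have hi := integrable_shift (integrable_deviation hφ) hG u
  set p := ∫ y, φ y ∂ν with hp
  have hb : ∀ x, G (u + deviation ν φ x) ∈ Set.Icc (G (u + p) - 1) (G (u + p)) := by
    intro x
    constructor
    · rw [sub_eq_add_neg, ← hadd]
      refine hmono fun i => ?_
      have := hφ1 x i
      simp only [deviation, ← hp, Pi.add_apply, Pi.sub_apply, Pi.one_apply] at *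
      linarith
    · refine hmono fun i => ?_
      have := hφ0 x i
      simp only [deviation, ← hp, Pi.add_apply, Pi.sub_apply, Pi.zero_apply] at *
      linarith
  rw [lintShift, ← ofReal_integral_eq_lintegral_ofReal
    (integrable_exp_mul_of_mem_Icc hi.1.aemeasurable (.of_forall hb))
    (.of_forall fun _ => Real.exp_nonneg _)]
  exact ENNReal.ofReal_le_ofReal (integral_exp_le_of_mem_Icc hi.1.aemeasurable hb s)

variable [Nonempty ι]

theorem iterate_shiftAvg_maxCoord_monotone {ν : Measure E} [IsProbabilityMeasure ν]
    {f : E → ι → ℝ} (hf : Integrable f ν) (k : ℕ) :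
    Monotone ((shiftAvg ν f)^[k] maxCoord) := by
  induction k with
  | zero => exact fun u v h => maxCoord_mono h
  | succ k ih =>
    have hk := lipschitz_iterate_shiftAvg hf (lipschitz_maxCoord (ι := ι)) k
    rw [Function.iterate_succ_apply']
    exact fun u v h => integral_mono (integrable_shift hf hk u) (integrable_shift hf hk v)
      fun x => ih (add_le_add_left h _)

theorem iterate_shiftAvg_maxCoord_add_const {ν : Measure E} [IsProbabilityMeasure ν]
    {f : E → ι → ℝ} (hf : Integrable f ν) (k : ℕ) (u : ι → ℝ) (c : ℝ) :
    (shiftAvg ν f)^[k] maxCoord (fun i => u i + c) = (shiftAvg ν f)^[k] maxCoord u + c := by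
  induction k generalizing u with
  | zero => exact maxCoord_add_const u c
  | succ k ih =>
    have hk := lipschitz_iterate_shiftAvg hf (lipschitz_maxCoord (ι := ι)) k
    rw [Function.iterate_succ_apply']
    have e : ∀ x, (shiftAvg ν f)^[k] maxCoord ((fun i => u i + c) + f x) =
        (shiftAvg ν f)^[k] maxCoord (u + f x) + c := by
      intro x
      rw [← ih]
      refine congrArg _ (funext fun i => ?_)
      simp only [Pi.add_apply]
      ring
    simp only [shiftAvg] at e ⊢
    simp_rw [e]
    rw [integral_add (integrable_shift hf hk u) (integrable_const _)]
    simp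

/-- The exponential moment form of the bounded difference inequality for the maximal deviation. -/
theorem iterate_lintShift_exp_le {ν : Measure E} [IsProbabilityMeasure ν] {φ : E → ι → ℝ}
    (hφ : Integrable φ ν) (hφ0 : ∀ x, 0 ≤ φ x) (hφ1 : ∀ x, φ x ≤ 1) (s : ℝ) (k : ℕ)
    (u : ι → ℝ) :
    (lintShift ν (deviation ν φ))^[k] (fun u => ENNReal.ofReal (Real.exp (s * maxCoord u))) u ≤
      ENNReal.ofReal (Real.exp (k * (s ^ 2 / 8))) *
        ENNReal.ofReal (Real.exp (s * (shiftAvg ν (deviation ν φ))^[k] maxCoord u)) := by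
  have hd := integrable_deviation hφ
  induction k generalizing u with
  | zero => simp
  | succ k ih =>
    rw [Function.iterate_succ_apply']
    refine (lintShift_mono _ _ ih u).trans ?_
    rw [lintShift_const_mul _ _ ENNReal.ofReal_ne_top]
    refine (mul_le_mul_right (lintShift_exp_le hφ hφ0 hφ1
      (lipschitz_iterate_shiftAvg hd lipschitz_maxCoord k)
      (iterate_shiftAvg_maxCoord_monotone hd k)
      (iterate_shiftAvg_maxCoord_add_const hd k) s u) _).trans_eq ?_
    rw [← ENNReal.ofReal_mul (Real.exp_nonneg _), ← ENNReal.ofReal_mul (Real.exp_nonneg _),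
      ← Real.exp_add, ← Real.exp_add, Function.iterate_succ_apply']
    congr 2
    push_cast
    ring

/-- Upper tail of the maximal deviation of `k` independent samples. -/
theorem iterate_lintShift_indicator_le {ν : Measure E} [IsProbabilityMeasure ν] {φ : E → ι → ℝ}
    (hφ : Integrable φ ν) (hφ0 : ∀ x, 0 ≤ φ x) (hφ1 : ∀ x, φ x ≤ 1) {q : ℝ} (hq : 0 ≤ q) (k : ℕ)
    (hk : (shiftAvg ν (deviation ν φ))^[k] maxCoord 0 ≤ q * k) :
    (lintShift ν (deviation ν φ))^[k] ({u | 2 * q * k ≤ maxCoord u}.indicator 1) 0 ≤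
      ENNReal.ofReal (Real.exp (-(2 * q ^ 2 * k))) := by
  -- Chernoff bound with the optimal `s = 4q`: the threshold contributes `-8q²k`, the mean at most
  -- `4q²k` and the variance term `2q²k`, leaving `-2q²k`.
  have hle : {u : ι → ℝ | 2 * q * k ≤ maxCoord u}.indicator (1 : (ι → ℝ) → ℝ≥0∞) ≤ fun u =>
      ENNReal.ofReal (Real.exp (-(8 * q ^ 2 * k))) *
        ENNReal.ofReal (Real.exp (4 * q * maxCoord u)) := by
    refine Set.indicator_le fun u hu => ?_
    rw [← ENNReal.ofReal_mul (Real.exp_nonneg _), ← Real.exp_add, Pi.one_apply,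
      ← ENNReal.ofReal_one]
    refine ENNReal.ofReal_le_ofReal (Real.one_le_exp ?_)
    have hu' : 2 * q * k ≤ maxCoord u := hu
    nlinarith
  have hconst : ∀ (c : ℝ≥0∞) (_ : c ≠ ∞) (G : (ι → ℝ) → ℝ≥0∞) (j : ℕ),
      (lintShift ν (deviation ν φ))^[j] (fun u => c * G u) =
        fun u => c * (lintShift ν (deviation ν φ))^[j] G u := by
    intro c hc G j
    induction j with
    | zero => rfl
    | succ j ih =>
      rw [Function.iterate_succ_apply', ih, Function.iterate_succ_apply']
      exact funext fun u => lintShift_const_mul _ _ hc _ u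
  refine ((lintShift_mono ν (deviation ν φ)).iterate k hle 0).trans ?_
  rw [hconst _ ENNReal.ofReal_ne_top]
  refine (mul_le_mul_right (iterate_lintShift_exp_le hφ hφ0 hφ1 (4 * q) k 0) _).trans ?_
  rw [← ENNReal.ofReal_mul (Real.exp_nonneg _), ← ENNReal.ofReal_mul (Real.exp_nonneg _),
    ← Real.exp_add, ← Real.exp_add]
  refine ENNReal.ofReal_le_ofReal (Real.exp_le_exp.2 ?_)
  nlinarith [mul_le_mul_of_nonneg_left hk hq]

end Hoeffding

/-! ### Total variation and bounded test functions. -/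

section TotalVariation

variable {E : Type*} [MeasurableSpace E]

theorem measure_le_add_tvDist (P Q : Measure E) [IsFiniteMeasure P] [IsFiniteMeasure Q]
    {A : Set E} (hA : MeasurableSet A) : P A ≤ Q A + tvDist P Q := by
  have h : ENNReal.ofReal |P.real A - Q.real A| ≤ tvDist P Q :=
    le_iSup₂ (f := fun (A : Set E) (_ : MeasurableSet A) =>
      ENNReal.ofReal |P.real A - Q.real A|) A hA
  refine le_trans ?_ (add_le_add_right h _)
  rw [← ofReal_measureReal (μ := P), ← ofReal_measureReal (μ := Q),
    ← ENNReal.ofReal_add measureReal_nonneg (abs_nonneg _)]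
  exact ENNReal.ofReal_le_ofReal (by linarith [le_abs_self (P.real A - Q.real A)])

/-- Expectations of functions with values in `[0, 1]` differ by at most the total variation
distance. -/
theorem lintegral_le_add_tvDist (P Q : Measure E) [IsFiniteMeasure P] [IsFiniteMeasure Q]
    {f : E → ℝ≥0∞} (hf : Measurable f) (hf1 : ∀ x, f x ≤ 1) :
    ∫⁻ x, f x ∂P ≤ ∫⁻ x, f x ∂Q + tvDist P Q := by
  have hg : Measurable fun x => (f x).toReal := hf.ennreal_toReal
  have e : ∀ M : Measure E, ∫⁻ x, f x ∂M = ∫⁻ t in Set.Ioi 0, M {x | t < (f x).toReal} := by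
    intro M
    rw [← lintegral_eq_lintegral_meas_lt M (.of_forall fun _ => ENNReal.toReal_nonneg)
      hg.aemeasurable]
    exact lintegral_congr fun x =>
      (ENNReal.ofReal_toReal (ne_top_of_le_ne_top ENNReal.one_ne_top (hf1 x))).symm
  rw [e P, e Q]
  -- In the layer-cake formula the levels `t ≥ 1` are empty, so the error is integrated only over
  -- `(0, 1)` and carries the constant one.
  have hle : ∀ t : ℝ, P {x | t < (f x).toReal} ≤
      Q {x | t < (f x).toReal} + (Set.Iio 1).indicator (fun _ => tvDist P Q) t := by
    intro t
    by_cases ht : t < 1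
    · rw [Set.indicator_of_mem (by exact ht)]
      exact measure_le_add_tvDist P Q (measurableSet_lt measurable_const hg)
    · have : {x | t < (f x).toReal} = ∅ := by
        ext x
        simp only [Set.mem_ofPred_eq, Set.mem_empty_iff_false, iff_false, not_lt]
        exact (ENNReal.toReal_mono ENNReal.one_ne_top (hf1 x)).trans (by simpa using ht)
      simp [this]
  refine (lintegral_mono hle).trans ?_
  rw [lintegral_add_right _ (measurable_const.indicator measurableSet_Iio)]
  refine add_le_add_right (le_of_eq ?_) _
  rw [lintegral_indicator measurableSet_Iio, lintegral_const, Measure.restrict_restrict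
    measurableSet_Iio, Measure.restrict_apply_univ, Set.Iio_inter_Ioi]
  simp

end TotalVariation

/-! ### Coupling-free comparison with independent draws. -/

section ConditionalLaw

variable {Ω E W : Type*} [MeasurableSpace E] [MeasurableSpace W]

theorem measurable_lintShift [AddCommGroup W] [MeasurableAdd₂ W] {ν : Measure E} [SFinite ν] {f : E → W} (hf : Measurable f)
    {G : W → ℝ≥0∞} (hG : Measurable G) : Measurable (lintShift ν f G) :=
  Measurable.lintegral_prod_right' (f := fun z : W × E => G (z.1 + f z.2))
    (hG.comp (measurable_fst.add (hf.comp measurable_snd)))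

variable [StandardBorelSpace E] [Nonempty E]

/-- Disintegration of the joint law of `Z` and `Y`. Keeping `Ω'` separate from `Ω` allows `Z` to be
the identity from `Ω` to `Ω` with a coarser σ-algebra. -/
theorem lintegral_condDistrib {Ω' : Type*} [MeasurableSpace Ω] [MeasurableSpace Ω']
    (μ : Measure Ω) [IsFiniteMeasure μ] {Y : Ω → E} (hY : Measurable Y) {Z : Ω → Ω'}
    (hZ : Measurable Z) {S : Ω' → W} (hS : Measurable S) {H : W × E → ℝ≥0∞} (hH : Measurable H) :
    ∫⁻ ω, H (S (Z ω), Y ω) ∂μ =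
      ∫⁻ ω, ∫⁻ y, H (S (Z ω), y) ∂(condDistrib Y Z μ (Z ω)) ∂μ := by
  have hF : Measurable fun z : Ω' × E => H (S z.1, z.2) :=
    hH.comp ((hS.comp measurable_fst).prodMk measurable_snd)
  rw [← lintegral_map (f := fun z : Ω' × E => H (S z.1, z.2)) hF (hZ.prodMk hY),
    ← compProd_map_condDistrib hY.aemeasurable, Measure.lintegral_compProd hF,
    lintegral_map hF.lintegral_kernel_prod_right' hZ]

theorem lintegral_condLaw {m mΩ : MeasurableSpace Ω} (hm : m ≤ mΩ) (μ : Measure Ω)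
    [IsFiniteMeasure μ] {Y : Ω → E} (hY : Measurable Y) {S : Ω → W} (hS : Measurable[m] S)
    {H : W × E → ℝ≥0∞} (hH : Measurable H) :
    ∫⁻ ω, H (S ω, Y ω) ∂μ = ∫⁻ ω, ∫⁻ y, H (S ω, y) ∂(condLaw m μ Y ω) ∂μ :=
  @lintegral_condDistrib Ω E W _ _ _ _ Ω mΩ m μ _ Y hY (fun ω => ω)
    (measurable_id'' hm) S hS H hH

theorem isProbabilityMeasure_condLaw (m : MeasurableSpace Ω) {mΩ : MeasurableSpace Ω}
    (μ : Measure Ω) [IsFiniteMeasure μ] (Y : Ω → E) (ω : Ω) :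
    IsProbabilityMeasure (condLaw m μ Y ω) := by
  unfold condLaw
  infer_instance

/-- Replacing one variable by an independent copy with law `ν` costs the expected total variation
distance of its conditional law to `ν`. -/
theorem lintegral_le_lintegral_add_tvDist {m mΩ : MeasurableSpace Ω} (hm : m ≤ mΩ)
    (μ : Measure Ω) [IsFiniteMeasure μ] (ν : Measure E) [IsFiniteMeasure ν] {Y : Ω → E}
    (hY : Measurable Y) {S : Ω → W} (hS : Measurable[m] S) {H : W × E → ℝ≥0∞}
    (hH : Measurable H) (hH1 : ∀ z, H z ≤ 1) :
    ∫⁻ ω, H (S ω, Y ω) ∂μ ≤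
      ∫⁻ ω, ∫⁻ y, H (S ω, y) ∂ν ∂μ + ∫⁻ ω, tvDist (condLaw m μ Y ω) ν ∂μ := by
  have hg : Measurable fun ω => ∫⁻ y, H (S ω, y) ∂ν :=
    (hH.lintegral_prod_right' (ν := ν)).comp (hS.mono hm le_rfl)
  rw [lintegral_condLaw hm μ hY hS hH, ← lintegral_add_left hg]
  refine lintegral_mono fun ω => ?_
  have := isProbabilityMeasure_condLaw m μ Y ω
  exact lintegral_le_add_tvDist _ _ (hH.comp measurable_prodMk_left) fun _ => hH1 _

/-- Comparison of a sum along a mixing sequence with the sum of independent samples. -/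
theorem lintegral_sum_le_iterate_lintShift [AddCommGroup W] [MeasurableAdd₂ W]
    {mΩ : MeasurableSpace Ω} (μ : Measure Ω)
    [IsProbabilityMeasure μ] (ν : Measure E) [IsProbabilityMeasure ν] (ℱ : Filtration ℕ mΩ)
    {Y : ℕ → Ω → E} (hY : ∀ l, Measurable[ℱ (l + 1)] (Y l)) {β : ℝ≥0∞}
    (hβ : ∀ l, ∫⁻ ω, tvDist (condLaw (ℱ l) μ (Y l) ω) ν ∂μ ≤ β) {f : E → W}
    (hf : Measurable f) (k : ℕ) {G : W → ℝ≥0∞} (hG : Measurable G) (hG1 : ∀ u, G u ≤ 1) :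
    ∫⁻ ω, G (∑ l ∈ Finset.range k, f (Y l ω)) ∂μ ≤ (lintShift ν f)^[k] G 0 + k * β := by
  induction k generalizing G with
  | zero => simp
  | succ k ih =>
    have hS : Measurable[ℱ k] fun ω => ∑ l ∈ Finset.range k, f (Y l ω) :=
      Finset.measurable_fun_sum _ fun l hl =>
        hf.comp ((hY l).mono (ℱ.mono (Finset.mem_range.1 hl)) le_rfl)
    have h1 := lintegral_le_lintegral_add_tvDist (ℱ.le k) μ ν ((hY k).mono (ℱ.le _) le_rfl) hS
      (H := fun z => G (z.1 + f z.2))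
      (hG.comp (measurable_fst.add (hf.comp measurable_snd))) fun _ => hG1 _
    -- The latest variable is averaged out first; the result is a function of the shorter sum, still
    -- measurable and bounded by one, so it can serve as the new test function.
    have h2 := ih (measurable_lintShift (ν := ν) hf hG) fun u =>
      (lintegral_mono fun x => hG1 (u + f x)).trans (by simp)
    simp only [Finset.sum_range_succ]
    refine h1.trans ((add_le_add h2 (hβ k)).trans_eq ?_)
    rw [Function.iterate_succ_apply, Nat.cast_succ, add_mul, one_mul, add_assoc]

end ConditionalLaw

/-! ### Variational description of the smallest eigenvalue. -/

section SmallestEigenvalue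

variable {n : ℕ}

theorem isHermitian_sampleCov (N : ℕ) (x : ℕ → EuclideanSpace ℝ (Fin n)) :
    (sampleCov N x).IsHermitian := by
  ext i j
  simp [sampleCov, Matrix.sum_apply, Matrix.vecMulVec_apply, mul_comm]

theorem dotProduct_sampleCov_mulVec (N : ℕ) (x : ℕ → EuclideanSpace ℝ (Fin n))
    (t : EuclideanSpace ℝ (Fin n)) :
    t.ofLp ⬝ᵥ (sampleCov N x).mulVec t.ofLp =
      1 / (N : ℝ) * ∑ k ∈ Finset.Icc 1 N, inner ℝ t (x k) ^ 2 := by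
  rw [sampleCov, Matrix.smul_mulVec, dotProduct_smul, Matrix.sum_mulVec, dotProduct_sum,
    smul_eq_mul]
  congr 1
  refine Finset.sum_congr rfl fun k _ => ?_
  rw [Matrix.vecMulVec_mulVec, EuclideanSpace.inner_eq_star_dotProduct]
  simp [dotProduct_comm, sq]

/-- A small smallest eigenvalue is witnessed by a unit direction of small empirical energy. -/
theorem exists_direction_of_lambdaMin_lt (hn : 1 ≤ n) {N : ℕ}
    {x : ℕ → EuclideanSpace ℝ (Fin n)} {c : ℝ} (h : lambdaMin (sampleCov N x) < c) :
    ∃ t : EuclideanSpace ℝ (Fin n), ‖t‖ = 1 ∧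
      1 / (N : ℝ) * ∑ k ∈ Finset.Icc 1 N, inner ℝ t (x k) ^ 2 < c := by
  have hA := isHermitian_sampleCov N x
  -- For `n = 0` the spectrum is empty and `sInf` would take its default value; here the infimum is
  -- an attained eigenvalue.
  have : Nonempty (Fin n) := ⟨⟨0, hn⟩⟩
  obtain ⟨i, hi⟩ : sInf (spectrum ℝ (sampleCov N x)) ∈ Set.range hA.eigenvalues := by
    rw [hA.spectrum_real_eq_range_eigenvalues]
    exact (Set.range_nonempty _).csInf_mem (Set.finite_range _)
  refine ⟨hA.eigenvectorBasis i, hA.eigenvectorBasis.orthonormal.1 i, ?_⟩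
  rw [← dotProduct_sampleCov_mulVec, hA.mulVec_eigenvectorBasis, hi, dotProduct_smul]
  have h1 : (hA.eigenvectorBasis i).ofLp ⬝ᵥ (hA.eigenvectorBasis i).ofLp = 1 := by
    have := real_inner_self_eq_norm_sq (hA.eigenvectorBasis i)
    rw [hA.eigenvectorBasis.orthonormal.1 i, EuclideanSpace.inner_eq_star_dotProduct] at this
    simpa using this
  rw [h1, smul_eq_mul, mul_one]
  exact h

end SmallestEigenvalue

/-! ### A Lipschitz minorant of the square. -/

section Ramp

/-- The piecewise linear function which vanishes for `|s| ≤ τ / 2` and equals `1` for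
`τ ≤ |s|`. -/
noncomputable def ramp (τ s : ℝ) : ℝ := max 0 (min 1 (2 * |s| / τ - 1))

theorem ramp_nonneg (τ s : ℝ) : 0 ≤ ramp τ s := le_max_left _ _

theorem ramp_le_one (τ s : ℝ) : ramp τ s ≤ 1 := max_le zero_le_one (min_le_left _ _)

theorem ramp_eq_one {τ s : ℝ} (hτ : 0 < τ) (h : τ ≤ |s|) : ramp τ s = 1 := by
  have : 1 ≤ 2 * |s| / τ - 1 := by
    rw [le_sub_iff_add_le, le_div_iff₀ hτ]
    linarith
  rw [ramp, min_eq_left this]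
  simp

theorem ramp_mul_le_sq {τ : ℝ} (hτ : 0 < τ) (s : ℝ) : τ ^ 2 / 4 * ramp τ s ≤ s ^ 2 := by
  rcases le_or_gt |s| (τ / 2) with h | h
  · have : 2 * |s| / τ - 1 ≤ 0 := by
      rw [sub_nonpos, div_le_one hτ]
      linarith
    rw [ramp, max_eq_left ((min_le_right _ _).trans this), mul_zero]
    exact sq_nonneg s
  · have h1 := ramp_le_one τ s
    have h2 : (τ / 2) ^ 2 ≤ |s| ^ 2 := pow_le_pow_left₀ (by positivity) h.le 2
    rw [sq_abs] at h2
    nlinarith [sq_nonneg τ]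

theorem continuous_ramp (τ : ℝ) : Continuous (ramp τ) := by
  unfold ramp
  fun_prop

/-- The ramp has slope `2 / τ`; the factor 2 from symmetrization makes it `4 / τ`. This is the
hypothesis of the contraction step. -/
theorem abs_ramp_sub_le {τ : ℝ} (hτ : 0 < τ) (s t : ℝ) :
    |2 * ramp τ s - 2 * ramp τ t| ≤ |4 / τ * s - 4 / τ * t| := by
  have h1 : |ramp τ s - ramp τ t| ≤ |2 * |s| / τ - 1 - (2 * |t| / τ - 1)| := by
    refine (abs_max_sub_max_le_max _ _ _ _).trans ?_
    rw [sub_self, abs_zero]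
    refine max_le (abs_nonneg _) ((abs_min_sub_min_le_max _ _ _ _).trans ?_)
    rw [sub_self, abs_zero]
    exact max_le (abs_nonneg _) le_rfl
  have h2 : 2 * |s| / τ - 1 - (2 * |t| / τ - 1) = 2 / τ * (|s| - |t|) := by ring
  rw [h2, abs_mul, abs_of_pos (by positivity : 0 < 2 / τ)] at h1
  rw [← mul_sub, ← mul_sub, abs_mul, abs_mul, abs_of_pos (by positivity : 0 < 4 / τ), abs_two]
  have h3 := mul_le_mul_of_nonneg_left (abs_abs_sub_abs_le_abs_sub s t)
    (by positivity : 0 ≤ 2 / τ)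
  calc 2 * |ramp τ s - ramp τ t| ≤ 2 * (2 / τ * |s - t|) := by linarith
    _ = 4 / τ * |s - t| := by ring

end Ramp

/-! ### Ramp features under the stationary law and along a mixing sequence. -/

section SmallBall

variable {n : ℕ}

theorem smallBall_le (ν : Measure (EuclideanSpace ℝ (Fin n))) (τ : ℝ)
    {t : EuclideanSpace ℝ (Fin n)} (ht : ‖t‖ = 1) :
    smallBall ν τ ≤ ν.real {x | τ ≤ |inner ℝ t x|} :=
  ciInf_le (f := fun t : Metric.sphere (0 : EuclideanSpace ℝ (Fin n)) 1 =>
    ν.real {x | τ ≤ |inner ℝ t.1 x|})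
    ⟨0, by rintro _ ⟨t, rfl⟩; exact measureReal_nonneg⟩ ⟨t, by simpa using ht⟩

theorem exists_unit_vector (hn : 1 ≤ n) : ∃ t : EuclideanSpace ℝ (Fin n), ‖t‖ = 1 :=
  ⟨EuclideanSpace.single ⟨0, hn⟩ 1, by simp⟩

theorem smallBall_le_one (hn : 1 ≤ n) (ν : Measure (EuclideanSpace ℝ (Fin n)))
    [IsProbabilityMeasure ν] (τ : ℝ) : smallBall ν τ ≤ 1 := by
  obtain ⟨t, ht⟩ := exists_unit_vector hn
  exact (smallBall_le ν τ ht).trans measureReal_le_one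

/-- Markov's inequality in one direction. It makes the second moment positive and, later, forces the
number of blocks to be large. -/
theorem sq_mul_smallBall_le (hn : 1 ≤ n) {ν : Measure (EuclideanSpace ℝ (Fin n))}
    [IsProbabilityMeasure ν] (hν : Integrable (fun x => ‖x‖ ^ 2) ν) {τ : ℝ} (hτ : 0 < τ) :
    τ ^ 2 * smallBall ν τ ≤ ∫ x, ‖x‖ ^ 2 ∂ν := by
  obtain ⟨t, ht⟩ := exists_unit_vector hn
  refine le_trans ?_ (mul_meas_ge_le_integral_of_nonneg (.of_forall fun x => sq_nonneg ‖x‖) hν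
    (τ ^ 2))
  refine mul_le_mul_of_nonneg_left ((smallBall_le ν τ ht).trans
    (measureReal_mono fun x hx => ?_)) (sq_nonneg τ)
  have h := abs_real_inner_le_norm t x
  rw [ht, one_mul] at h
  exact pow_le_pow_left₀ hτ.le (le_trans hx h) 2

variable {ι : Type*}

/-- The ramp features in the directions `d i`. -/
noncomputable def rampFeature (τ : ℝ) (d : ι → EuclideanSpace ℝ (Fin n))
    (x : EuclideanSpace ℝ (Fin n)) : ι → ℝ := fun i => ramp τ (inner ℝ (d i) x)

theorem continuous_rampFeature (τ : ℝ) (d : ι → EuclideanSpace ℝ (Fin n)) :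
    Continuous (rampFeature τ d) :=
  continuous_pi fun _ => (continuous_ramp τ).comp (continuous_const.inner continuous_id)

variable [Fintype ι]

theorem integrable_rampFeature (ν : Measure (EuclideanSpace ℝ (Fin n))) [IsFiniteMeasure ν]
    (τ : ℝ) (d : ι → EuclideanSpace ℝ (Fin n)) : Integrable (rampFeature τ d) ν := by
  refine Integrable.of_bound (continuous_rampFeature τ d).aestronglyMeasurable 1
    (.of_forall fun x => (pi_norm_le_iff_of_nonneg zero_le_one).2 fun i => ?_)
  exact (Real.norm_of_nonneg (ramp_nonneg _ _)).trans_le (ramp_le_one _ _)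

/-- The ramp dominates the indicator of `τ ≤ |s|`. -/
theorem smallBall_le_integral_rampFeature (ν : Measure (EuclideanSpace ℝ (Fin n)))
    [IsFiniteMeasure ν] {τ : ℝ} (hτ : 0 < τ) {d : ι → EuclideanSpace ℝ (Fin n)}
    (hd : ∀ i, ‖d i‖ = 1) (i : ι) : smallBall ν τ ≤ (∫ x, rampFeature τ d x ∂ν) i := by
  have hi : ∀ i, Integrable (fun x => rampFeature τ d x i) ν :=
    fun i => (integrable_rampFeature ν τ d).eval i
  have hm : MeasurableSet {x | τ ≤ |inner ℝ (d i) x|} :=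
    measurableSet_le measurable_const (by fun_prop)
  rw [eval_integral hi]
  refine (smallBall_le ν τ (hd i)).trans ?_
  rw [← integral_indicator_one hm]
  refine integral_mono ((integrable_const _).indicator hm) (hi i) fun x => ?_
  refine Set.indicator_le' (fun x hx => ?_) (fun x _ => ramp_nonneg _ _) x
  exact (ramp_eq_one hτ hx).ge

theorem integrable_linFeature {ν : Measure (EuclideanSpace ℝ (Fin n))} [IsFiniteMeasure ν]
    (hν : Integrable (fun x => ‖x‖ ^ 2) ν) (c : ℝ) (d : ι → EuclideanSpace ℝ (Fin n)) :
    Integrable (linFeature c d) ν := by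
  have hid : Integrable (fun x : EuclideanSpace ℝ (Fin n) => x) ν := by
    refine Integrable.mono' ((integrable_const 1).add hν) measurable_id.aestronglyMeasurable
      (.of_forall fun x => ?_)
    simp only [Pi.add_apply]
    nlinarith [sq_nonneg (‖x‖ - 1)]
  exact Integrable.of_eval fun i => (hid.const_inner (d i)).const_mul c

variable [Nonempty ι]

/-- Along a mixing sequence the ramp features are uniformly large with high probability. -/
theorem measure_maxCoord_deviation_le (hn : 1 ≤ n) {Ω : Type*} {mΩ : MeasurableSpace Ω}
    (μ : Measure Ω) [IsProbabilityMeasure μ] {ν : Measure (EuclideanSpace ℝ (Fin n))}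
    [IsProbabilityMeasure ν] (hν : Integrable (fun x => ‖x‖ ^ 2) ν) {τ : ℝ} (hτ : 0 < τ)
    (hQ : 0 < smallBall ν τ) (ℱ : Filtration ℕ mΩ) {Y : ℕ → Ω → EuclideanSpace ℝ (Fin n)}
    (hY : ∀ l, Measurable[ℱ (l + 1)] (Y l)) {β : ℝ≥0∞}
    (hβ : ∀ l, ∫⁻ ω, tvDist (condLaw (ℱ l) μ (Y l) ω) ν ∂μ ≤ β)
    {d : ι → EuclideanSpace ℝ (Fin n)} (hd : ∀ i, ‖d i‖ = 1) {q : ℝ} (hq : 0 ≤ q) (m : ℕ)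
    (hm : 4 / τ * √(m * ∫ x, ‖x‖ ^ 2 ∂ν) ≤ q * m) :
    μ {ω | 2 * q * m ≤
        maxCoord (∑ l ∈ Finset.range m, deviation ν (rampFeature τ d) (Y l ω))} ≤
      ENNReal.ofReal (Real.exp (-(2 * q ^ 2 * m))) + m * β := by
  have hφ := integrable_rampFeature ν τ d
  have hσ : 0 < ∫ x, ‖x‖ ^ 2 ∂ν :=
    (mul_pos (pow_pos hτ 2) hQ).trans_le (sq_mul_smallBall_le hn hν hτ)
  have hmean : (shiftAvg ν (deviation ν (rampFeature τ d)))^[m] maxCoord 0 ≤ q * m := by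
    have h := iterate_shiftAvg_linFeature_le hφ (c := 4 / τ) (by positivity) (fun i => (hd i).le)
      (integrable_linFeature hν _ d) (fun x i j => abs_ramp_sub_le hτ _ _) hν hσ m 0
    have h0 : linFeature (4 / τ) d 0 = 0 := by ext i; simp [linFeature]
    rw [h0, norm_zero, zero_pow two_ne_zero, zero_add] at h
    exact h.trans hm
  have hset : MeasurableSet {u : ι → ℝ | 2 * q * m ≤ maxCoord u} :=
    measurableSet_le measurable_const lipschitz_maxCoord.continuous.measurable
  have hdev : Measurable (deviation ν (rampFeature τ d)) :=
    (continuous_const.sub (continuous_rampFeature τ d)).measurable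
  have hS : Measurable fun ω => ∑ l ∈ Finset.range m, deviation ν (rampFeature τ d) (Y l ω) :=
    Finset.measurable_fun_sum _ fun l _ => hdev.comp ((hY l).mono (ℱ.le _) le_rfl)
  have h := lintegral_sum_le_iterate_lintShift μ ν ℱ hY hβ hdev m
    (G := {u : ι → ℝ | 2 * q * m ≤ maxCoord u}.indicator 1) (measurable_one.indicator hset)
    fun u => Set.indicator_le_self' (fun _ _ => zero_le) u
  have e : ∫⁻ ω, {u : ι → ℝ | 2 * q * m ≤ maxCoord u}.indicator (1 : (ι → ℝ) → ℝ≥0∞)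
      (∑ l ∈ Finset.range m, deviation ν (rampFeature τ d) (Y l ω)) ∂μ =
      μ {ω | 2 * q * m ≤
        maxCoord (∑ l ∈ Finset.range m, deviation ν (rampFeature τ d) (Y l ω))} := by
    exact lintegral_indicator_one (hS hset)
  rw [e] at h
  exact h.trans (add_le_add_left (iterate_lintShift_indicator_le hφ
    (fun x i => ramp_nonneg _ _) (fun x i => ramp_le_one _ _) hq m hmean) _)

end SmallBall

/-! ### Blocking and the choice of constants. -/

section Blocks

theorem sum_range_mul_eq (g : ℕ → ℝ) (a m : ℕ) :
    ∑ k ∈ Finset.range (m * a), g k =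
      ∑ j ∈ Finset.range a, ∑ l ∈ Finset.range m, g (j + l * a) := by
  induction m with
  | zero => simp
  | succ m ih =>
    simp only [Finset.sum_range_succ, Finset.sum_add_distrib, ← ih]
    rw [Nat.succ_mul, Finset.sum_range_add]
    simp only [add_comm]

/-- The indices run once through `a + 1, …, a (m + 1)`. The first `a` are dropped because an
observation is compared with `ν` given the past `a` steps earlier, at a time at least 1. -/
theorem sum_blocks_le {g : ℕ → ℝ} (hg : ∀ k, 0 ≤ g k) {a m N : ℕ} (h : a * (m + 1) ≤ N) :
    ∑ j ∈ Finset.range a, ∑ l ∈ Finset.range m, g (j + 1 + l * a + a) ≤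
      ∑ k ∈ Finset.Icc 1 N, g k := by
  have e := sum_range_mul_eq (fun k => g (k + 1 + a)) a m
  have e2 : ∑ j ∈ Finset.range a, ∑ l ∈ Finset.range m, g (j + 1 + l * a + a) =
      ∑ k ∈ Finset.range (m * a), g (k + 1 + a) := by
    rw [e]
    refine Finset.sum_congr rfl fun j _ => Finset.sum_congr rfl fun l _ => ?_
    congr 1
    ring
  rw [e2]
  rw [← Finset.sum_image (f := g) (g := fun k => k + 1 + a) fun i _ j _ hij => by
    simpa using hij]
  refine Finset.sum_le_sum_of_subset_of_nonneg (fun k hk => ?_) fun k _ _ => hg k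
  obtain ⟨i, hi, rfl⟩ := Finset.mem_image.1 hk
  rw [Finset.mem_range] at hi
  rw [Finset.mem_Icc]
  constructor <;> nlinarith

/-- Choice of the block length and of the number of blocks. -/
theorem exists_block_parameters {L Q s τ δ : ℝ} {N : ℕ} (hL : 1 / 2 ≤ L) (hQ : 0 < Q)
    (hQ1 : Q ≤ 1) (hτ : 0 < τ) (hs : τ ^ 2 * Q ≤ s)
    (hN : L * (max (1024 * s / (τ ^ 2 * Q ^ 2)) (32 / Q ^ 2 * Real.log (4 * L / δ)) + 1) ≤ N) :
    ∃ a m : ℕ, 1 ≤ a ∧ L ≤ a ∧ a ≤ 2 * L ∧ a * (m + 1) ≤ N ∧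
      4 / τ * √(m * s) ≤ Q / 5 * m ∧ Real.log (4 * L / δ) ≤ 2 * (Q / 5) ^ 2 * m ∧
      (N : ℝ) / 2 ≤ 3 / 5 * (a * m) := by
  set M := max (1024 * s / (τ ^ 2 * Q ^ 2)) (32 / Q ^ 2 * Real.log (4 * L / δ)) with hM
  have hτQ : 0 < τ ^ 2 * Q ^ 2 := by positivity
  have hM1 : 1024 * s ≤ M * (τ ^ 2 * Q ^ 2) := (div_le_iff₀ hτQ).1 (le_max_left _ _)
  have hM2 : 32 * Real.log (4 * L / δ) ≤ M * Q ^ 2 := by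
    have h : 32 / Q ^ 2 * Real.log (4 * L / δ) ≤ M := le_max_right _ _
    rw [div_mul_eq_mul_div, div_le_iff₀ (by positivity)] at h
    exact h
  -- From `τ²Q ≤ s` and `Q ≤ 1`. Hence `m ≥ 500` below, which absorbs all rounding losses.
  have hM0 : 1024 ≤ M := by
    have h1 : 1024 * (τ ^ 2 * Q ^ 2) ≤ M * (τ ^ 2 * Q ^ 2) := by
      refine le_trans ?_ hM1
      have : τ ^ 2 * Q ^ 2 ≤ τ ^ 2 * Q :=
        mul_le_mul_of_nonneg_left (by nlinarith) (sq_nonneg τ)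
      linarith
    exact le_of_mul_le_mul_right h1 hτQ
  have hL0 : 0 < L := by linarith
  set a := ⌈L⌉₊ with ha
  have ha0 : 1 ≤ a := Nat.ceil_pos.2 hL0
  have haL : L ≤ a := Nat.le_ceil L
  -- The assumption `1 / 2 ≤ L` is needed when `L ≤ 1`, where `a = 1`.
  have ha2 : (a : ℝ) ≤ 2 * L := by
    rcases le_or_gt L 1 with h | h
    · have : a ≤ 1 := Nat.ceil_le.2 (by simpa using h)
      have : (a : ℝ) ≤ 1 := by exact_mod_cast this
      linarith
    · linarith [Nat.ceil_lt_add_one hL0.le]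
  have haN : a ≤ N := by
    have : (a : ℝ) ≤ N := by nlinarith
    exact_mod_cast this
  have hdiv : 1 ≤ N / a := (Nat.one_le_div_iff (by omega)).2 haN
  obtain ⟨m, hm⟩ : ∃ m, N / a = m + 1 := ⟨N / a - 1, by omega⟩
  have hNlt : (N : ℝ) < a * (m + 2) := by
    have := Nat.lt_mul_div_succ N (show 0 < a by omega)
    rw [hm] at this
    exact_mod_cast this
  -- Compare `L (M + 1) ≤ N` with `N < a (m + 2) ≤ 2L (m + 2)`.
  have hMm : M < 2 * m + 3 := by
    have h1 : L * (M + 1) < L * (2 * (m + 2)) := by nlinarith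
    linarith [lt_of_mul_lt_mul_left h1 hL0.le]
  have hm500 : (500 : ℝ) ≤ m := by linarith
  have haR : (1 : ℝ) ≤ a := by exact_mod_cast ha0
  refine ⟨a, m, ha0, haL, ha2, ?_, ?_, ?_, ?_⟩
  · rw [← hm]
    exact Nat.mul_div_le N a
  · have h1 : m * s ≤ (τ * Q * m / 20) ^ 2 := by
      have h2 : 400 * s ≤ τ ^ 2 * Q ^ 2 * m := by nlinarith
      have h3 := mul_le_mul_of_nonneg_left h2 (by positivity : (0 : ℝ) ≤ m)
      calc m * s = m * (400 * s) / 400 := by ring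
        _ ≤ m * (τ ^ 2 * Q ^ 2 * m) / 400 := by linarith
        _ = _ := by ring
    have h4 : √(m * s) ≤ τ * Q * m / 20 := Real.sqrt_le_iff.2 ⟨by positivity, h1⟩
    calc 4 / τ * √(m * s) ≤ 4 / τ * (τ * Q * m / 20) :=
          mul_le_mul_of_nonneg_left h4 (by positivity)
      _ = Q / 5 * m := by field_simp; norm_num
  · have hQ2 : 0 < Q ^ 2 := by positivity
    nlinarith
  · nlinarith

end Blocks

/-! ### Union bound over residue classes and passage to all directions. -/

section Assembly

variable {n : ℕ} {Ω : Type*} {mΩ : MeasurableSpace Ω}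

/-- The filtration sampled along an arithmetic progression. -/
def arithFiltration (ℱ : Filtration ℕ mΩ) (j a : ℕ) : Filtration ℕ mΩ where
  seq l := ℱ (j + l * a)
  mono' _ _ h := ℱ.mono (by gcongr)
  le' _ := ℱ.le _

theorem lintegral_tvDist_le_betaMixing {E : Type*} [MeasurableSpace E] [StandardBorelSpace E]
    [Nonempty E] (μ : Measure Ω) [IsFiniteMeasure μ] (ℱ : Filtration ℕ mΩ) (X : ℕ → Ω → E)
    (ν : Measure E) (k : ℕ) {t : ℕ} (ht : 1 ≤ t) :
    ∫⁻ ω, tvDist (condLaw (ℱ t) μ (X (t + k)) ω) ν ∂μ ≤ betaMixing μ ℱ X ν k :=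
  le_iSup₂ (f := fun (t : ℕ) (_ : 1 ≤ t) =>
    ∫⁻ ω, tvDist (condLaw (ℱ t) μ (X (t + k)) ω) ν ∂μ) t ht

/-- A lower bound for the energy in a direction, from the ramp features along the blocks. -/
theorem le_sum_sq_of_deviation_lt {ι : Type*} [Fintype ι]
    {ν : Measure (EuclideanSpace ℝ (Fin n))} [IsFiniteMeasure ν] {τ : ℝ} (hτ : 0 < τ)
    {d : ι → EuclideanSpace ℝ (Fin n)} (hd : ∀ i, ‖d i‖ = 1)
    {x : ℕ → EuclideanSpace ℝ (Fin n)} {a m N : ℕ} (haN : a * (m + 1) ≤ N) (i : ι)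
    (h : ∀ j ∈ Finset.range a, maxCoord (∑ l ∈ Finset.range m,
      deviation ν (rampFeature τ d) (x (j + 1 + l * a + a))) < 2 * (smallBall ν τ / 5) * m) :
    τ ^ 2 / 4 * (a * (3 / 5 * (smallBall ν τ * m))) ≤
      ∑ k ∈ Finset.Icc 1 N, inner ℝ (d i) (x k) ^ 2 := by
  refine le_trans ?_ (sum_blocks_le (fun k => sq_nonneg (inner ℝ (d i) (x k))) haN)
  have hblock : ∀ j ∈ Finset.range a, τ ^ 2 / 4 * (3 / 5 * (smallBall ν τ * m)) ≤
      ∑ l ∈ Finset.range m, inner ℝ (d i) (x (j + 1 + l * a + a)) ^ 2 := by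
    intro j hj
    have h1 := (le_maxCoord _ i).trans_lt (h j hj)
    rw [Finset.sum_apply] at h1
    simp only [deviation, Pi.sub_apply, Finset.sum_sub_distrib, Finset.sum_const,
      Finset.card_range, nsmul_eq_mul] at h1
    have h2 := mul_le_mul_of_nonneg_left (smallBall_le_integral_rampFeature ν hτ hd i)
      (Nat.cast_nonneg (α := ℝ) m)
    -- Each feature has mean at least `Q`, and the total shortfall is below `2Qm/5`.
    have h3 : 3 / 5 * (smallBall ν τ * m) ≤
        ∑ l ∈ Finset.range m, rampFeature τ d (x (j + 1 + l * a + a)) i := by linarith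
    refine (mul_le_mul_of_nonneg_left h3 (by positivity)).trans ?_
    rw [Finset.mul_sum]
    exact Finset.sum_le_sum fun l _ => ramp_mul_le_sq hτ _
  have h4 := Finset.sum_le_sum hblock
  rw [Finset.sum_const, Finset.card_range, nsmul_eq_mul] at h4
  linarith

/-- The geometric mixing rate beats the sample size at the chosen block length. -/
theorem pow_le_of_log_le {ρ K L : ℝ} (hρ0 : 0 < ρ) (hρ1 : ρ < 1) (hK : 0 < K)
    (hL : L = 1 / (1 - ρ) * Real.log K) {a : ℕ} (ha : L ≤ a) : ρ ^ a ≤ 1 / K := by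
  have h1 : 0 < 1 - ρ := by linarith
  -- This is what lets `1 / (1 - ρ)` replace `1 / log (1/ρ)` in the mixing time.
  have h2 : ρ ≤ Real.exp (-(1 - ρ)) := by linarith [Real.add_one_le_exp (-(1 - ρ))]
  calc ρ ^ a ≤ Real.exp (-(1 - ρ)) ^ a := pow_le_pow_left₀ hρ0.le h2 a
    _ = Real.exp (-((1 - ρ) * a)) := by rw [← Real.exp_nat_mul]; ring_nf
    _ ≤ Real.exp (-Real.log K) := by
        refine Real.exp_le_exp.2 (neg_le_neg ?_)
        have h3 : (1 - ρ) * L = Real.log K := by rw [hL]; field_simp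
        rw [← h3]
        exact mul_le_mul_of_nonneg_left ha h1.le
    _ = 1 / K := by rw [Real.exp_neg, Real.exp_log hK, one_div]

/-- The total failure probability over all blocks. -/
theorem failure_probability_le {δ Γ ρ L q : ℝ} {N a m : ℕ} (hδ0 : 0 < δ) (hΓ : 0 < Γ)
    (hρ0 : 0 < ρ) (hρ1 : ρ < 1) (hN : 1 ≤ N)
    (hL : L = 1 / (1 - ρ) * Real.log (2 * Γ * N / δ)) (hL0 : 0 < L) (haL : L ≤ a)
    (ha2 : (a : ℝ) ≤ 2 * L) (haN : a * (m + 1) ≤ N)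
    (hlog : Real.log (4 * L / δ) ≤ 2 * q ^ 2 * m) :
    a * (Real.exp (-(2 * q ^ 2 * m)) + m * (Γ * ρ ^ a)) ≤ δ := by
  have hNR : (0 : ℝ) < N := by exact_mod_cast hN
  have h1 : Real.exp (-(2 * q ^ 2 * m)) ≤ δ / (4 * L) := by
    refine (Real.exp_le_exp.2 (neg_le_neg hlog)).trans_eq ?_
    rw [Real.exp_neg, Real.exp_log (by positivity), inv_div]
  -- The budget `δ` is split evenly between concentration, here, and mixing, in `h5`.
  have h2 : a * Real.exp (-(2 * q ^ 2 * m)) ≤ δ / 2 := by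
    refine (mul_le_mul ha2 h1 (Real.exp_nonneg _) (by positivity)).trans_eq ?_
    field_simp
    norm_num
  have h3 : Γ * ρ ^ a ≤ Γ * (1 / (2 * Γ * N / δ)) :=
    mul_le_mul_of_nonneg_left (pow_le_of_log_le hρ0 hρ1 (by positivity) hL haL) hΓ.le
  have h4 : (a : ℝ) * m ≤ N := by
    have : a * m ≤ N := by nlinarith
    exact_mod_cast this
  have h5 : (a * m : ℝ) * (Γ * ρ ^ a) ≤ δ / 2 := by
    refine (mul_le_mul h4 h3 (by positivity) hNR.le).trans_eq ?_
    field_simp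
  linarith

/-- The lower bound for the energy in finitely many directions. -/
theorem measure_exists_direction_le (hn : 1 ≤ n) (μ : Measure Ω) [IsProbabilityMeasure μ]
    {ℱ : Filtration ℕ mΩ} {X : ℕ → Ω → EuclideanSpace ℝ (Fin n)}
    (hX : ∀ k : ℕ, 1 ≤ k → Measurable[ℱ k] (X k)) {ν : Measure (EuclideanSpace ℝ (Fin n))}
    [IsProbabilityMeasure ν] (hν : Integrable (fun x => ‖x‖ ^ 2) ν)
    {δ : ℝ} (hδ0 : 0 < δ) {Γ : ℝ} (hΓ : 0 < Γ) {ρ : ℝ} (hρ0 : 0 < ρ)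
    (hρ1 : ρ < 1)
    (hβ : ∀ a : ℕ, 1 ≤ a → betaMixing μ ℱ X ν a ≤ ENNReal.ofReal (Γ * ρ ^ a))
    {τ : ℝ} (hτ : 0 < τ) (hQ : 0 < smallBall ν τ) {N : ℕ} (hN0 : 1 ≤ N) {L : ℝ}
    (hL : 1 / 2 ≤ L) (hLdef : L = 1 / (1 - ρ) * Real.log (2 * Γ * N / δ))
    (hN : L * (max (1024 * (∫ x, ‖x‖ ^ 2 ∂ν) / (τ ^ 2 * smallBall ν τ ^ 2))
      (32 / smallBall ν τ ^ 2 * Real.log (4 * L / δ)) + 1) ≤ N)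
    {ι : Type*} [Fintype ι] [Nonempty ι] {d : ι → EuclideanSpace ℝ (Fin n)}
    (hd : ∀ i, ‖d i‖ = 1) :
    μ {ω | ∃ i, 1 / (N : ℝ) * ∑ k ∈ Finset.Icc 1 N, inner ℝ (d i) (X k ω) ^ 2 <
      τ ^ 2 * smallBall ν τ / 8} ≤ ENNReal.ofReal δ := by
  obtain ⟨a, m, ha1, haL, ha2, haN, hm, hlog, hsum⟩ := exists_block_parameters (δ := δ) hL hQ
    (smallBall_le_one hn ν τ) hτ (sq_mul_smallBall_le hn hν hτ) hN
  set Q := smallBall ν τ with hQdef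
  set bad : ℕ → Set Ω := fun j => {ω | 2 * (Q / 5) * m ≤ maxCoord (∑ l ∈ Finset.range m,
    deviation ν (rampFeature τ d) (X (j + 1 + l * a + a) ω))} with hbad
  have hsub : {ω | ∃ i, 1 / (N : ℝ) * ∑ k ∈ Finset.Icc 1 N, inner ℝ (d i) (X k ω) ^ 2 <
      τ ^ 2 * Q / 8} ⊆ ⋃ j ∈ Finset.range a, bad j := by
    rintro ω ⟨i, hi⟩
    by_contra hω
    simp only [hbad, Set.mem_iUnion, exists_prop, not_exists, not_and, Set.mem_ofPred_eq,
      not_le] at hω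
    have h1 := le_sum_sq_of_deviation_lt (x := fun k => X k ω) hτ hd haN i hω
    have hNR : (0 : ℝ) < N := by exact_mod_cast hN0
    rw [one_div_mul_eq_div, div_lt_iff₀ hNR] at hi
    have h2 := mul_le_mul_of_nonneg_left hsum (by positivity : 0 ≤ τ ^ 2 * Q / 4)
    simp only [← hQdef] at h1
    linarith
  have hblock : ∀ j, μ (bad j) ≤
      ENNReal.ofReal (Real.exp (-(2 * (Q / 5) ^ 2 * m)) + m * (Γ * ρ ^ a)) := by
    intro j
    rw [ENNReal.ofReal_add (Real.exp_nonneg _) (by positivity),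
      ENNReal.ofReal_mul (Nat.cast_nonneg m), ENNReal.ofReal_natCast]
    -- The classes start at `j + 1` since the mixing coefficient only controls conditioning times `t
    -- ≥ 1`.
    refine measure_maxCoord_deviation_le hn μ hν hτ hQ (arithFiltration ℱ (j + 1) a)
      (Y := fun l => X (j + 1 + l * a + a)) (fun l => ?_) (fun l => ?_) hd
      (by positivity) m hm
    · refine (hX (j + 1 + l * a + a) (by omega)).mono (ℱ.mono ?_) le_rfl
      rw [Nat.succ_mul, add_assoc]
    · exact (lintegral_tvDist_le_betaMixing μ ℱ X ν a (by omega)).trans (hβ a ha1)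
  refine (measure_mono hsub).trans ((measure_biUnion_finset_le _ _).trans ?_)
  refine (Finset.sum_le_sum fun j _ => hblock j).trans ?_
  rw [Finset.sum_const, Finset.card_range, nsmul_eq_mul, ← ENNReal.ofReal_natCast,
    ← ENNReal.ofReal_mul (Nat.cast_nonneg a)]
  exact ENNReal.ofReal_le_ofReal (failure_probability_le hδ0 hΓ hρ0 hρ1 hN0 hLdef
    (by linarith) haL ha2 haN hlog)

/-- A continuous strict inequality satisfied somewhere on the unit sphere holds at a member of
a dense sequence. -/
theorem setOf_lambdaMin_lt_subset (hn : 1 ≤ n) {N : ℕ} {X : ℕ → Ω → EuclideanSpace ℝ (Fin n)}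
    {c : ℝ} {d : ℕ → Metric.sphere (0 : EuclideanSpace ℝ (Fin n)) 1} (hd : DenseRange d) :
    {ω | lambdaMin (sampleCov N fun k => X k ω) < c} ⊆
      ⋃ K : ℕ, {ω | ∃ i : Fin (K + 1),
        1 / (N : ℝ) * ∑ k ∈ Finset.Icc 1 N, inner ℝ (d i).1 (X k ω) ^ 2 < c} := by
  intro ω hω
  obtain ⟨t, ht, htc⟩ := exists_direction_of_lambdaMin_lt hn hω
  have hopen : IsOpen {s : Metric.sphere (0 : EuclideanSpace ℝ (Fin n)) 1 |
      1 / (N : ℝ) * ∑ k ∈ Finset.Icc 1 N, inner ℝ s.1 (X k ω) ^ 2 < c} :=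
    isOpen_lt (by fun_prop) continuous_const
  obtain ⟨K, hK⟩ := hd.exists_mem_open hopen ⟨⟨t, by simpa using ht⟩, htc⟩
  exact Set.mem_iUnion.2 ⟨K, Fin.last K, hK⟩

end Assembly

end MixingCovariance

/-! ### The main theorem. -/

theorem mainTheorem1 {n : ℕ} (hn : 1 ≤ n)
    {Ω : Type*} {mΩ : MeasurableSpace Ω} (μ : Measure Ω) [IsProbabilityMeasure μ]
    (ℱ : Filtration ℕ mΩ) (X : ℕ → Ω → EuclideanSpace ℝ (Fin n))
    (hX : ∀ k : ℕ, 1 ≤ k → Measurable[ℱ k] (X k))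
    (ν : Measure (EuclideanSpace ℝ (Fin n))) [IsProbabilityMeasure ν]
    (hν : Integrable (fun x => ‖x‖ ^ 2) ν)
    (δ : ℝ) (hδ0 : 0 < δ) (hδ1 : δ < 1)
    (Γ : ℝ) (hΓ : 0 < Γ) (ρ : ℝ) (hρ0 : 0 < ρ) (hρ1 : ρ < 1)
    (hβ : ∀ a : ℕ, 1 ≤ a →
      MixingCovariance.betaMixing μ ℱ X ν a ≤ ENNReal.ofReal (Γ * ρ ^ a))
    (τ : ℝ) (hτ : 0 < τ) (hQ : 0 < MixingCovariance.smallBall ν τ)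
    (N : ℕ) (hN0 : 1 ≤ N)
    (hL : 1 / 2 ≤ 1 / (1 - ρ) * Real.log (2 * Γ * N / δ))
    (hN : 1 / (1 - ρ) * Real.log (2 * Γ * N / δ) *
        (max (1024 * (∫ x, ‖x‖ ^ 2 ∂ν) / (τ ^ 2 * MixingCovariance.smallBall ν τ ^ 2))
          (32 / MixingCovariance.smallBall ν τ ^ 2 *
            Real.log (4 / (δ * (1 - ρ)) * Real.log (2 * Γ * N / δ))) + 1) ≤ (N : ℝ)) :
    ENNReal.ofReal (1 - δ) ≤
      μ {ω | τ ^ 2 * MixingCovariance.smallBall ν τ / 8 ≤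
        MixingCovariance.lambdaMin (MixingCovariance.sampleCov N (fun k => X k ω))} := by
  set L := 1 / (1 - ρ) * Real.log (2 * Γ * N / δ) with hLdef
  have e : 4 / (δ * (1 - ρ)) * Real.log (2 * Γ * N / δ) = 4 * L / δ := by
    have : 1 - ρ ≠ 0 := by linarith
    rw [hLdef]
    field_simp
  rw [e] at hN
  obtain ⟨t, ht⟩ := MixingCovariance.exists_unit_vector hn
  have : Nonempty (Metric.sphere (0 : EuclideanSpace ℝ (Fin n)) 1) := ⟨⟨t, by simpa using ht⟩⟩
  set d := TopologicalSpace.denseSeq (Metric.sphere (0 : EuclideanSpace ℝ (Fin n)) 1)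
  have hbad : μ {ω | MixingCovariance.lambdaMin
      (MixingCovariance.sampleCov N fun k => X k ω) <
        τ ^ 2 * MixingCovariance.smallBall ν τ / 8} ≤ ENNReal.ofReal δ := by
    refine (measure_mono (MixingCovariance.setOf_lambdaMin_lt_subset hn
      (TopologicalSpace.denseRange_denseSeq _))).trans ?_
    -- The events increase with the number of directions and their bound does not depend on it, so
    -- continuity from below costs nothing.
    rw [Monotone.measure_iUnion]
    · exact iSup_le fun K => MixingCovariance.measure_exists_direction_le hn μ hX hν hδ0 hΓ hρ0
        hρ1 hβ hτ hQ hN0 hL hLdef hN (d := fun i : Fin (K + 1) => (d i).1)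
        fun i => by simp
    · rintro K K' hK ω ⟨i, hi⟩
      exact ⟨Fin.castLE (by omega) i, hi⟩
  -- Subadditivity suffices for passing to the complement, so measurability of the smallest
  -- eigenvalue is not required.
  have hcover := measure_union_le (μ := μ)
    {ω | τ ^ 2 * MixingCovariance.smallBall ν τ / 8 ≤
        MixingCovariance.lambdaMin (MixingCovariance.sampleCov N (fun k => X k ω))}
    {ω | MixingCovariance.lambdaMin (MixingCovariance.sampleCov N fun k => X k ω) <
        τ ^ 2 * MixingCovariance.smallBall ν τ / 8}
  have huniv : {ω | τ ^ 2 * MixingCovariance.smallBall ν τ / 8 ≤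
        MixingCovariance.lambdaMin (MixingCovariance.sampleCov N (fun k => X k ω))} ∪
      {ω | MixingCovariance.lambdaMin (MixingCovariance.sampleCov N fun k => X k ω) <
        τ ^ 2 * MixingCovariance.smallBall ν τ / 8} = Set.univ :=
    Set.eq_univ_of_forall fun ω => le_or_gt (τ ^ 2 * MixingCovariance.smallBall ν τ / 8)
      (MixingCovariance.lambdaMin (MixingCovariance.sampleCov N fun k => X k ω))
  rw [huniv, measure_univ] at hcover
  rw [ENNReal.ofReal_sub _ hδ0.le, ENNReal.ofReal_one]
  exact tsub_le_iff_right.2 (hcover.trans (by gcongr))
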